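/- Let $\mathbb{X}$ be a Polish space and let $X=(X_t)_{t=0,1,\dots}$ be a time-homogeneous $\mathbb{X}$-valued Markov process with transition kernel $Q$; write $\mathbb{E}^x$ for expectation given $X_0=x$. Let $f:\mathbb{X}\to\mathbb{R}$ be nonnegative, bounded and Borel measurable, and let $\delta:\{0,1,2,\dots\}\to[0,1]$ be strictly decreasing with $\delta(0)=1$ and $\lim_{k\to\infty}\delta(k)=0$. For $x\in\mathbb{X}$ and a stopping time $\tau$ of the filtration generated by $X$ put $J(x,\tau):=\mathbb{E}^x[\delta(\tau)f(X_\tau)]$, where $\delta(\tau)f(X_\tau):=0$ on $\{\tau=\infty\}$. For a Borel set $S\subseteq\mathbb{X}$ and the process started at $x$ let $\rho(x,S):=\inf\{t\ge 1: X_t\in S\}$ and $$\Theta(S):=\{x\in\mathbb{X}: f(x)\ge J(x,\rho(x,S))\}.$$ A Borel set $S$ is called an equilibrium if $\Theta(S)=S$; let $\mathcal{E}$ be the set of all equilibria. For $S\in\mathcal{E}$ let $V(x,S):=\max\{f(x),J(x,\rho(x,S))\}$. An equilibrium $S^*$ is called optimal if $V(x,S^*)\ge V(x,S)$ for all $S\in\mathcal{E}$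 and all $x\in\mathbb{X}$. Suppose that $\delta(i)\delta(j)\le\delta(i+j)$ for all $i,j\ge 0$, that $f$ is upper semicontinuous, and that for every bounded Borel measurable $g:\mathbb{X}\to\mathbb{R}$ and every sequence $x_n\to x$ in $\mathbb{X}$, $$\liminf_{n\to\infty}\int_{\mathbb{X}} g(y)\,Q(x_n,dy)\ \ge\ \int_{\mathbb{X}} g(y)\,Q(x,dy).$$ Then every equilibrium is a closed subset of $\mathbb{X}$, and the intersection $S^*:=\bigcap_{S\in\mathcal{E}}S$ of all equilibria is itself an equilibrium and is the optimal equilibrium, i.e. it is optimal and it is the only optimal equilibrium. -/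

import Mathlib

open MeasureTheory ProbabilityTheory Filter Topology

namespace OptimalStopping

/-- A discount function: `δ : {0, 1, 2, …} → [0, 1]` is strictly decreasing, with `δ 0 = 1` and
`δ k → 0` as `k → ∞`. -/
structure IsDiscount (δ : ℕ → ℝ) : Prop where
  mem_Icc : ∀ k, δ k ∈ Set.Icc (0 : ℝ) 1
  strictAnti : StrictAnti δ
  zero : δ 0 = 1
  tendsto : Tendsto δ atTop (𝓝 0)

/-- Condition (DI): the discount function is log sub-additive (decreasing impatience). -/
def DecreasingImpatience (δ : ℕ → ℝ) : Prop :=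
  ∀ i j : ℕ, δ i * δ j ≤ δ (i + j)

/-- A payoff function: nonnegative, bounded and Borel measurable. -/
structure IsPayoff {E : Type*} [MeasurableSpace E] (f : E → ℝ) : Prop where
  nonneg : ∀ x, 0 ≤ f x
  bounded : ∃ M : ℝ, ∀ x, f x ≤ M
  measurable : Measurable f

/-- `X = (X_t)_{t = 0, 1, …}`, under the probabilities `P x`, `x ∈ E`, is a time-homogeneous Markov
process with state space `E` and transition kernel `Q`. Here `P x` is the probability given
`X_0 = x`, and the Markov property refers to the filtration generated by `X`. -/
structure IsMarkovProcess {E Ω : Type*} [TopologicalSpace E] [PolishSpace E]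
    [MeasurableSpace E] [BorelSpace E] [MeasurableSpace Ω]
    (Q : Kernel E E) (P : E → Measure Ω) (X : ℕ → Ω → E) : Prop where
  isProbabilityMeasure : ∀ x, IsProbabilityMeasure (P x)
  measurable : ∀ t, Measurable (X t)
  start : ∀ x, ∀ᵐ ω ∂(P x), X 0 ω = x
  markov : ∀ (x : E) (t : ℕ) (A : Set E), MeasurableSet A →
    (P x)[(X (t + 1) ⁻¹' A).indicator (fun _ => (1 : ℝ)) |
        Filtration.natural X (fun s => (measurable s).stronglyMeasurable) t]
      =ᵐ[P x] fun ω => (Q (X t ω)).real A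

/-- The kernel `Q` is lower semicontinuous under the weak star topology, tested against all
bounded Borel measurable functions. -/
def KernelLowerSemicontinuous {E : Type*} [MeasurableSpace E] [TopologicalSpace E]
    (Q : Kernel E E) : Prop :=
  ∀ g : E → ℝ, Measurable g → (∃ C : ℝ, ∀ y, |g y| ≤ C) →
    ∀ (u : ℕ → E) (x : E), Tendsto u atTop (𝓝 x) →
      ∫ y, g y ∂(Q x) ≤ liminf (fun n => ∫ y, g y ∂(Q (u n))) atTop

section Equilibria

variable {E Ω : Type*} [MeasurableSpace E] [MeasurableSpace Ω]

/-- The discounted payoff `δ(τ) f(X_τ)`, equal to `0` where `τ = ∞`. -/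
noncomputable def discountedPayoff (δ : ℕ → ℝ) (f : E → ℝ) (X : ℕ → Ω → E)
    (τ : Ω → WithTop ℕ) (ω : Ω) : ℝ :=
  if τ ω = ⊤ then 0 else δ (τ ω).untopA * f (stoppedValue X τ ω)

/-- The objective function `J(x, τ) = 𝔼^x[δ(τ) f(X_τ)]`. -/
noncomputable def objective (δ : ℕ → ℝ) (f : E → ℝ) (P : E → Measure Ω) (X : ℕ → Ω → E)
    (x : E) (τ : Ω → WithTop ℕ) : ℝ :=
  ∫ ω, discountedPayoff δ f X τ ω ∂(P x)

/-- `ρ(S) = inf {t ≥ 1 : X_t ∈ S}`, equal to `∞` if there is no such `t`. -/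
noncomputable def returnTime (X : ℕ → Ω → E) (S : Set E) : Ω → WithTop ℕ :=
  hittingAfter X S 1

/-- `Θ(S) = {x : f(x) ≥ J(x, ρ(x, S))}`. -/
def bestResponse (δ : ℕ → ℝ) (f : E → ℝ) (P : E → Measure Ω) (X : ℕ → Ω → E)
    (S : Set E) : Set E :=
  {x | f x ≥ objective δ f P X x (returnTime X S)}

/-- The set `𝓔` of all equilibria: the Borel sets `S` with `Θ(S) = S`. -/
def equilibria (δ : ℕ → ℝ) (f : E → ℝ) (P : E → Measure Ω) (X : ℕ → Ω → E) : Set (Set E) :=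
  {S | MeasurableSet S ∧ bestResponse δ f P X S = S}

/-- The value function `V(x, S) = f(x) ∨ J(x, ρ(x, S))`. -/
noncomputable def value (δ : ℕ → ℝ) (f : E → ℝ) (P : E → Measure Ω) (X : ℕ → Ω → E)
    (x : E) (S : Set E) : ℝ :=
  max (f x) (objective δ f P X x (returnTime X S))

/-- `S` is an optimal equilibrium: an equilibrium whose value dominates, at every state, that of
every equilibrium. -/
def IsOptimalEquilibrium (δ : ℕ → ℝ) (f : E → ℝ) (P : E → Measure Ω) (X : ℕ → Ω → E)
    (S : Set E) : Prop :=
  S ∈ equilibria δ f P X ∧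
    ∀ T ∈ equilibria δ f P X, ∀ x, value δ f P X x T ≤ value δ f P X x S

end Equilibria

end OptimalStopping

namespace OptimalStopping

/-! The engine is a comparison principle, `objective_returnTime_le`. Let `B` lie in every region of
a family, and suppose that at each point of a region outside `B` waiting for some region of the
family is worth at least `f`. Then waiting for `B` is worth at least as much as waiting for any of
the regions. Indeed, whenever a region says stop outside `B`, one continues with a better region
instead; decreasing impatience keeps this favourable when judged from an earlier date, and
postponing for `n` steps costs at most a multiple of `δ n`, which vanishes.

Equilibria are closed, because `J` is lower and `f` upper semicontinuous in the state, so their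
intersection `I` is Borel. A point outside `I` misses some equilibrium `R = Θ(R)`, where `J > f`.
Comparison gives `J(·, S) ≤ J(·, I)` for every equilibrium `S`; hence `Θ(I) ⊆ I`. Iterating `Θ` from
`I` decreases to an equilibrium inside `I`, which minimality forces to be `I`. Optimality is the
comparison itself. -/

open Classical in
lemma piecewise_mem_Icc {E : Type*} {A : Set E} {g h : E → ℝ} {M : ℝ} (hg : ∀ y, g y ∈ Set.Icc 0 M)
    (hh : ∀ y, h y ∈ Set.Icc 0 M) (y : E) : A.piecewise g h y ∈ Set.Icc 0 M := by
  by_cases hy : y ∈ A <;> simp only [Set.piecewise, hy, if_true, if_false, hg y, hh y]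

lemma IsDiscount.mul_mem_Icc {δ : ℕ → ℝ} (hδ : IsDiscount δ) {M a : ℝ} (ha : a ∈ Set.Icc 0 M) (k : ℕ) :
    δ k * a ∈ Set.Icc 0 M :=
  ⟨mul_nonneg (hδ.mem_Icc k).1 ha.1,
    (mul_le_of_le_one_left ha.1 (hδ.mem_Icc k).2).trans ha.2⟩

/-! ### Finite-horizon values computed from the kernel -/

section Kernel

variable {E : Type*} [MeasurableSpace E]

/-- A measurable function with values in `[0, M]` is integrable for every finite measure. -/
lemma integrable_of_nonneg_of_le {μ : Measure E} [IsFiniteMeasure μ] {g : E → ℝ} {M : ℝ}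
    (hg : Measurable g) (h0 : ∀ y, 0 ≤ g y) (hM : ∀ y, g y ≤ M) : Integrable g μ :=
  Integrable.of_bound hg.aestronglyMeasurable M
    (ae_of_all _ fun y => by rw [Real.norm_eq_abs, abs_of_nonneg (h0 y)]; exact hM y)

/-- The integral against a composition of a measure with a kernel is the iterated integral. -/
lemma integral_measure_comp {μ : Measure E} [IsFiniteMeasure μ] (Q : Kernel E E)
    [IsMarkovKernel Q] {g : E → ℝ} (hg : Integrable g (Q ∘ₘ μ)) :
    ∫ y, g y ∂(Q ∘ₘ μ) = ∫ x, ∫ y, g y ∂(Q x) ∂μ := by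
  rw [Measure.comp_eq_comp_const_apply] at hg ⊢
  rw [Kernel.integral_comp hg, Kernel.const_apply]

open Classical in
/-- The expected payoff of stopping at the first entrance into `A` among the next `N` steps of the
chain with kernel `Q`, the discounting having started `s` periods ago; the payoff is `0` if `A` is
not entered within these `N` steps. -/
noncomputable def truncatedValue (Q : Kernel E E) (δ : ℕ → ℝ) (f : E → ℝ) (A : Set E) :
    ℕ → ℕ → E → ℝ
  | 0, _, _ => 0
  | N + 1, s, x =>
    ∫ y, A.piecewise (fun y => δ (s + 1) * f y) (truncatedValue Q δ f A N (s + 1)) y ∂(Q x)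

variable (Q : Kernel E E) {δ : ℕ → ℝ} {f : E → ℝ}

lemma measurable_truncatedValue (hf : Measurable f) {A : Set E} (hA : MeasurableSet A) (N s : ℕ) :
    Measurable (truncatedValue Q δ f A N s) := by
  classical
  induction N generalizing s with
  | zero => exact measurable_const
  | succ N ih =>
    exact (StronglyMeasurable.integral_kernel (Measurable.piecewise hA (hf.const_mul _)
      (ih (s + 1))).stronglyMeasurable).measurable

lemma integral_mem_Icc {μ : Measure E} [IsProbabilityMeasure μ] {g : E → ℝ} {M : ℝ}
    (hg : Measurable g) (h : ∀ y, g y ∈ Set.Icc 0 M) : ∫ y, g y ∂μ ∈ Set.Icc 0 M := by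
  refine ⟨integral_nonneg fun y => (h y).1, ?_⟩
  calc ∫ y, g y ∂μ ≤ ∫ _, M ∂μ :=
        integral_mono (integrable_of_nonneg_of_le hg (fun y => (h y).1) fun y => (h y).2)
          (integrable_const M) fun y => (h y).2
    _ = M := by simp

lemma truncatedValue_mem_Icc [IsMarkovKernel Q] (hδ : IsDiscount δ) (hf : Measurable f)
    {A : Set E} (hA : MeasurableSet A) {M : ℝ} (hM : 0 ≤ M) (hfM : ∀ y, f y ∈ Set.Icc 0 M)
    (N s : ℕ) (x : E) : truncatedValue Q δ f A N s x ∈ Set.Icc 0 M := by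
  classical
  induction N generalizing s x with
  | zero => exact ⟨le_rfl, hM⟩
  | succ N ih =>
    exact integral_mem_Icc (Measurable.piecewise hA (hf.const_mul _)
      (measurable_truncatedValue Q hf hA N (s + 1)))
      (piecewise_mem_Icc (fun y => hδ.mul_mem_Icc (hfM y) _) (ih (s + 1)))

/-- Truncated values are continuous along decreasing sequences of stopping regions. -/
lemma tendsto_truncatedValue_iInter [IsMarkovKernel Q] (hδ : IsDiscount δ) (hf : Measurable f)
    {M : ℝ} (hM : 0 ≤ M) (hfM : ∀ y, f y ∈ Set.Icc 0 M) {S : ℕ → Set E}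
    (hS : ∀ n, MeasurableSet (S n)) (hanti : Antitone S) (N s : ℕ) (x : E) :
    Tendsto (fun n => truncatedValue Q δ f (S n) N s x) atTop
      (𝓝 (truncatedValue Q δ f (⋂ n, S n) N s x)) := by
  classical
  induction N generalizing s x with
  | zero => exact tendsto_const_nhds
  | succ N ih =>
    refine tendsto_integral_of_dominated_convergence (fun _ => M)
      (fun n => (Measurable.piecewise (hS n) (hf.const_mul _)
        (measurable_truncatedValue Q hf (hS n) N (s + 1))).aestronglyMeasurable)
      (integrable_const M) (fun n => ae_of_all _ fun y => ?_) (ae_of_all _ fun y => ?_)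
    · have h := piecewise_mem_Icc (A := S n) (fun y => hδ.mul_mem_Icc (hfM y) (s + 1))
        (truncatedValue_mem_Icc Q hδ hf (hS n) hM hfM N (s + 1)) y
      rw [Real.norm_eq_abs, abs_of_nonneg h.1]
      exact h.2
    · by_cases hy : y ∈ ⋂ n, S n
      · have hy' : ∀ n, y ∈ S n := Set.mem_iInter.1 hy
        simp only [Set.piecewise, hy, hy', if_true]
        exact tendsto_const_nhds
      · obtain ⟨m, hm⟩ : ∃ m, y ∉ S m := by simpa using hy
        -- The regions decrease, so `y` lies outside all of them from index `m` on and only the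
        -- continuation branch matters.
        refine Tendsto.congr' ?_ (by simpa only [Set.piecewise, hy, if_false] using ih (s + 1) y)
        filter_upwards [eventually_ge_atTop m] with n hn
        have hyn : y ∉ S n := fun h => hm (hanti hn h)
        simp only [Set.piecewise, hyn, if_false]

end Kernel

/-! ### Pathwise payoffs and their truncation -/

section SamplePath

variable {E Ω : Type*}

open Classical in
/-- The payoff collected along a path after time `t`, at its first visit to `A` at one of the
times `t + 1, …, t + N`, the discounting having started `s` periods before time `t`. -/
noncomputable def pathPayoff (δ : ℕ → ℝ) (f : E → ℝ) (X : ℕ → Ω → E) (A : Set E) :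
    ℕ → ℕ → ℕ → Ω → ℝ
  | 0, _, _, _ => 0
  | N + 1, s, t, ω =>
    if X (t + 1) ω ∈ A then δ (s + 1) * f (X (t + 1) ω)
    else pathPayoff δ f X A N (s + 1) (t + 1) ω

variable {δ : ℕ → ℝ} {f : E → ℝ} {X : ℕ → Ω → E} {A : Set E}

lemma pathPayoff_mem_Icc (hδ : IsDiscount δ) {M : ℝ} (hM : 0 ≤ M)
    (hfM : ∀ y, f y ∈ Set.Icc 0 M) (N s t : ℕ) (ω : Ω) :
    pathPayoff δ f X A N s t ω ∈ Set.Icc 0 M := by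
  classical
  induction N generalizing s t with
  | zero => exact ⟨le_rfl, hM⟩
  | succ N ih =>
    unfold pathPayoff
    split_ifs
    · exact hδ.mul_mem_Icc (hfM _) _
    · exact ih _ _

lemma pathPayoff_eq_zero {N : ℕ} (s t : ℕ) {ω : Ω}
    (h : ∀ j, t < j → j ≤ t + N → X j ω ∉ A) : pathPayoff δ f X A N s t ω = 0 := by
  induction N generalizing s t with
  | zero => rfl
  | succ N ih =>
    rw [pathPayoff, if_neg (h _ (by omega) (by omega))]
    exact ih _ _ fun j hj hj' => h j (by omega) (by omega)

lemma pathPayoff_eq_of_first_visit {N k : ℕ} (s t : ℕ) {ω : Ω} (hk : k + 1 ≤ N)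
    (hmem : X (t + (k + 1)) ω ∈ A) (h : ∀ j, t < j → j < t + (k + 1) → X j ω ∉ A) :
    pathPayoff δ f X A N s t ω = δ (s + (k + 1)) * f (X (t + (k + 1)) ω) := by
  induction N generalizing s t k with
  | zero => omega
  | succ N ih =>
    rcases k with _ | k
    · rw [pathPayoff, if_pos hmem]
    · rw [pathPayoff, if_neg (h _ (by omega) (by omega)),
        ih (k := k) (s + 1) (t + 1) (by omega)
          (by rwa [show t + 1 + (k + 1) = t + (k + 1 + 1) by omega])
          fun j hj hj' => h j (by omega) (by omega)]
      rw [show t + 1 + (k + 1) = t + (k + 1 + 1) by omega,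
        show s + 1 + (k + 1) = s + (k + 1 + 1) by omega]

/-- Stopping at the return time agrees with stopping within the next `N` steps, up to payoffs that
are discounted by at least `N` periods. -/
lemma discountedPayoff_mem_Icc (hδ : IsDiscount δ) {M : ℝ} (hM : 0 ≤ M)
    (hfM : ∀ y, f y ∈ Set.Icc 0 M) (N s : ℕ) (ω : Ω) :
    discountedPayoff (fun k => δ (s + k)) f X (returnTime X A) ω ∈
      Set.Icc (pathPayoff δ f X A N s 0 ω) (pathPayoff δ f X A N s 0 ω + M * δ (s + N)) := by
  have hpos : 0 ≤ M * δ (s + N) := mul_nonneg hM (hδ.mem_Icc _).1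
  unfold discountedPayoff
  by_cases htop : returnTime X A ω = ⊤
  · rw [if_pos htop, pathPayoff_eq_zero]
    · simpa using hpos
    · exact fun j hj _ => hittingAfter_eq_top_iff.1 htop j (by omega)
  · rw [if_neg htop]
    obtain ⟨k, hk⟩ := WithTop.ne_top_iff_exists.1 htop
    have hmem : X k ω ∈ A := by
      have := hittingAfter_mem_set_of_ne_top (u := X) (s := A) (n := 1) htop
      change X (returnTime X A ω).untopA ω ∈ A at this
      rwa [← hk] at this
    have hlt : ∀ j, 0 < j → j < k → X j ω ∉ A := fun j hj hjk =>
      notMem_of_lt_hittingAfter (n := 1) (lt_of_lt_of_eq (WithTop.coe_lt_coe.2 hjk) hk) hj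
    have h1 : 1 ≤ k := by
      have := le_hittingAfter (u := X) (s := A) (n := 1) ω
      exact WithTop.coe_le_coe.1 (this.trans_eq hk.symm)
    obtain ⟨l, rfl⟩ : ∃ l, k = l + 1 := ⟨k - 1, by omega⟩
    have hval : stoppedValue X (returnTime X A) ω = X (l + 1) ω := by
      rw [stoppedValue, ← hk]
      rfl
    rw [hval, ← hk]
    change δ (s + (l + 1)) * f (X (l + 1) ω) ∈ _
    -- A first visit within the horizon is seen exactly by the truncation; a later one is missed,
    -- and monotonicity of `δ` bounds the loss by `M * δ (s + N)`.
    by_cases hN : l + 1 ≤ N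
    · rw [pathPayoff_eq_of_first_visit s 0 hN (by simpa using hmem)
        (by simpa using fun j hj hj' => hlt j hj hj')]
      simpa using hpos
    · rw [pathPayoff_eq_zero s 0 fun j hj hj' => hlt j hj (by omega), zero_add]
      refine ⟨mul_nonneg (hδ.mem_Icc _).1 (hfM _).1, ?_⟩
      rw [mul_comm]
      exact mul_le_mul (hfM _).2 (hδ.strictAnti.antitone (by omega)) (hδ.mem_Icc _).1 hM

variable [MeasurableSpace E]

lemma measurable_pathPayoff [MeasurableSpace Ω] (hf : Measurable f)
    (hX : ∀ t, Measurable (X t)) (hA : MeasurableSet A) (N s t : ℕ) :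
    Measurable (pathPayoff δ f X A N s t) := by
  classical
  induction N generalizing s t with
  | zero => exact measurable_const
  | succ N ih =>
    exact Measurable.ite (hX (t + 1) hA) ((hf.comp (hX (t + 1))).const_mul _)
      (ih (s + 1) (t + 1))

lemma measurable_discountedPayoff [MeasurableSpace Ω] (hδ : IsDiscount δ) (hf : Measurable f)
    {M : ℝ} (hM : 0 ≤ M) (hfM : ∀ y, f y ∈ Set.Icc 0 M) (hX : ∀ t, Measurable (X t))
    (hA : MeasurableSet A) (s : ℕ) :
    Measurable (discountedPayoff (fun k => δ (s + k)) f X (returnTime X A)) := by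
  refine measurable_of_tendsto_metrizable
    (fun N => measurable_pathPayoff (δ := δ) hf hX hA N s 0) (tendsto_pi_nhds.2 fun ω => ?_)
  have hlim : Tendsto (fun N => M * δ (s + N)) atTop (𝓝 0) := by
    have := (hδ.tendsto.comp (tendsto_add_atTop_nat s)).const_mul M
    simpa [Function.comp_def, add_comm] using this
  refine tendsto_of_tendsto_of_tendsto_of_le_of_le
    (by simpa using tendsto_const_nhds.sub hlim) tendsto_const_nhds (fun N => ?_) (fun N => ?_)
  · exact sub_le_iff_le_add.2
      (discountedPayoff_mem_Icc (X := X) (A := A) hδ hM hfM N s ω).2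
  · exact (discountedPayoff_mem_Icc hδ hM hfM N s ω).1

end SamplePath

/-! ### Values with discounting already under way -/

section DelayedValue

variable {E Ω : Type*} [MeasurableSpace Ω]

/-- The value of the return time of `A`, when discounting started `s` periods ago. -/
noncomputable def delayedValue (δ : ℕ → ℝ) (f : E → ℝ) (P : E → Measure Ω) (X : ℕ → Ω → E)
    (A : Set E) (s : ℕ) (x : E) : ℝ :=
  objective (fun k => δ (s + k)) f P X x (returnTime X A)

lemma delayedValue_zero (δ : ℕ → ℝ) (f : E → ℝ) (P : E → Measure Ω) (X : ℕ → Ω → E)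
    (A : Set E) (x : E) :
    delayedValue δ f P X A 0 x = objective δ f P X x (returnTime X A) := by
  simp [delayedValue]

lemma lt_objective_of_notMem_bestResponse {δ : ℕ → ℝ} {f : E → ℝ}
    {P : E → Measure Ω} {X : ℕ → Ω → E} {A : Set E} {x : E} (hx : x ∉ bestResponse δ f P X A) :
    f x < objective δ f P X x (returnTime X A) :=
  not_le.1 hx

end DelayedValue

/-! ### From the Markov property to expected path payoffs -/

section Markov

variable {E Ω : Type*} [TopologicalSpace E] [PolishSpace E] [MeasurableSpace E] [BorelSpace E]
  [MeasurableSpace Ω] {Q : Kernel E E} [IsMarkovKernel Q] {P : E → Measure Ω} {X : ℕ → Ω → E}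

/-- The filtration generated by the process. -/
noncomputable abbrev IsMarkovProcess.filtration (hX : IsMarkovProcess Q P X) :
    Filtration ℕ (inferInstance : MeasurableSpace Ω) :=
  Filtration.natural X fun s => (hX.measurable s).stronglyMeasurable

/-- On an event of the past, the law of the next state is obtained from the law of the present
state by applying the transition kernel. -/
lemma IsMarkovProcess.map_succ_restrict (hX : IsMarkovProcess Q P X) (x : E) (t : ℕ) {F : Set Ω}
    (hF : MeasurableSet[hX.filtration t] F) :
    ((P x).restrict F).map (X (t + 1)) = Q ∘ₘ ((P x).restrict F).map (X t) := by
  have := hX.isProbabilityMeasure x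
  have hF' : MeasurableSet F := hX.filtration.le t F hF
  ext A hA
  rw [← measureReal_eq_measureReal_iff, map_measureReal_apply (hX.measurable _) hA]
  have hint : Integrable ((X (t + 1) ⁻¹' A).indicator fun _ => (1 : ℝ)) (P x) :=
    (integrable_const 1).indicator (hX.measurable _ hA)
  have h1 := setIntegral_condExp (hX.filtration.le t) hint hF
  rw [setIntegral_congr_ae hF' ((hX.markov x t A hA).mono fun ω hω _ => hω)] at h1
  have h2 : ∫ ω in F, (X (t + 1) ⁻¹' A).indicator (fun _ => (1 : ℝ)) ω ∂(P x) =
      ((P x).restrict F).real (X (t + 1) ⁻¹' A) := integral_indicator_one (hX.measurable _ hA)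
  rw [← h2, ← h1, ← integral_indicator_one hA, integral_measure_comp]
  · rw [integral_map (hX.measurable t).aemeasurable]
    · simp [integral_indicator_one hA]
    · exact (StronglyMeasurable.integral_kernel
        (stronglyMeasurable_one.indicator hA)).aestronglyMeasurable
  · exact (integrable_const 1).indicator hA

/-- The Markov property for bounded test functions. -/
lemma IsMarkovProcess.setIntegral_succ (hX : IsMarkovProcess Q P X) (x : E) (t : ℕ) {F : Set Ω}
    (hF : MeasurableSet[hX.filtration t] F) {g : E → ℝ} {M : ℝ} (hg : Measurable g)
    (hgM : ∀ y, g y ∈ Set.Icc 0 M) :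
    ∫ ω in F, g (X (t + 1) ω) ∂(P x) = ∫ ω in F, ∫ y, g y ∂(Q (X t ω)) ∂(P x) := by
  have := hX.isProbabilityMeasure x
  -- Equality of laws already contains the passage from indicators to general `g`.
  rw [← integral_map (hX.measurable _).aemeasurable hg.aestronglyMeasurable,
    hX.map_succ_restrict x t hF, integral_measure_comp, integral_map (hX.measurable t).aemeasurable
      (StronglyMeasurable.integral_kernel hg.stronglyMeasurable).aestronglyMeasurable]
  exact integrable_of_nonneg_of_le hg (fun y => (hgM y).1) fun y => (hgM y).2

variable {δ : ℕ → ℝ} {f : E → ℝ} {A : Set E} {M : ℝ}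

/-- Localising to a past event `F` makes the induction close: after a step that misses `A`, the
remaining event `F \ X (t + 1) ⁻¹' A` is known at time `t + 1`. -/
lemma IsMarkovProcess.setIntegral_pathPayoff (hX : IsMarkovProcess Q P X) (hδ : IsDiscount δ)
    (hf : Measurable f) (hM : 0 ≤ M) (hfM : ∀ y, f y ∈ Set.Icc 0 M) (hA : MeasurableSet A)
    (x : E) (N s t : ℕ) {F : Set Ω} (hF : MeasurableSet[hX.filtration t] F) :
    ∫ ω in F, pathPayoff δ f X A N s t ω ∂(P x) =
      ∫ ω in F, truncatedValue Q δ f A N s (X t ω) ∂(P x) := by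
  classical
  have := hX.isProbabilityMeasure x
  induction N generalizing s t F with
  | zero => rfl
  | succ N ih =>
    set g : E → ℝ := A.piecewise (fun y => δ (s + 1) * f y) (truncatedValue Q δ f A N (s + 1))
      with hgdef
    have hg : Measurable g := Measurable.piecewise hA (hf.const_mul _)
      (measurable_truncatedValue Q hf hA N (s + 1))
    have hgM : ∀ y, g y ∈ Set.Icc 0 M := piecewise_mem_Icc
      (fun y => hδ.mul_mem_Icc (hfM y) _) (truncatedValue_mem_Icc Q hδ hf hA hM hfM N (s + 1))
    have hgi : Integrable (fun ω => g (X (t + 1) ω)) (P x) :=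
      integrable_of_nonneg_of_le (hg.comp (hX.measurable _)) (fun ω => (hgM _).1)
        fun ω => (hgM _).2
    have hpi : Integrable (pathPayoff δ f X A (N + 1) s t) (P x) :=
      integrable_of_nonneg_of_le (measurable_pathPayoff hf hX.measurable hA _ _ _)
        (fun ω => (pathPayoff_mem_Icc hδ hM hfM _ _ _ ω).1)
        fun ω => (pathPayoff_mem_Icc hδ hM hfM _ _ _ ω).2
    have hB : MeasurableSet[hX.filtration (t + 1)] (X (t + 1) ⁻¹' A) :=
      (Filtration.stronglyAdapted_natural
        (fun s => (hX.measurable s).stronglyMeasurable) (t + 1)).measurable hA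
    have hB' : MeasurableSet (X (t + 1) ⁻¹' A) := hX.measurable _ hA
    have hF' : MeasurableSet F := hX.filtration.le t F hF
    have hFsucc : MeasurableSet[hX.filtration (t + 1)] F := hX.filtration.mono (Nat.le_succ t) F hF
    change _ = ∫ ω in F, ∫ y, g y ∂(Q (X t ω)) ∂(P x)
    rw [← hX.setIntegral_succ x t hF hg hgM, ← integral_inter_add_sdiff hB' hpi.integrableOn,
      ← integral_inter_add_sdiff hB' hgi.integrableOn]
    congr 1
    · refine setIntegral_congr_fun (hF'.inter hB') fun ω hω => ?_
      have hω' : X (t + 1) ω ∈ A := hω.2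
      simp only [pathPayoff, hgdef, Set.piecewise, hω', if_true]
    · rw [setIntegral_congr_fun (g := pathPayoff δ f X A N (s + 1) (t + 1)) (hF'.diff hB')
          fun ω hω => ?_, ih (s + 1) (t + 1) (hFsucc.diff hB)]
      · refine setIntegral_congr_fun (hF'.diff hB') fun ω hω => ?_
        have hω' : X (t + 1) ω ∉ A := hω.2
        simp only [hgdef, Set.piecewise, hω', if_false]
      · have hω' : X (t + 1) ω ∉ A := hω.2
        simp only [pathPayoff, hω', if_false]

lemma IsMarkovProcess.integral_pathPayoff (hX : IsMarkovProcess Q P X) (hδ : IsDiscount δ)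
    (hf : Measurable f) (hM : 0 ≤ M) (hfM : ∀ y, f y ∈ Set.Icc 0 M) (hA : MeasurableSet A)
    (x : E) (N s : ℕ) :
    ∫ ω, pathPayoff δ f X A N s 0 ω ∂(P x) = truncatedValue Q δ f A N s x := by
  have := hX.isProbabilityMeasure x
  have h := hX.setIntegral_pathPayoff hδ hf hM hfM hA x N s 0 MeasurableSet.univ
  rw [setIntegral_univ, setIntegral_univ] at h
  rw [h, integral_congr_ae ((hX.start x).mono fun ω hω => congrArg _ hω)]
  simp

end Markov

/-! ### Recursion, comparison and closedness for return-time values -/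

section Value

variable {E Ω : Type*} [TopologicalSpace E] [PolishSpace E] [MeasurableSpace E] [BorelSpace E]
  [MeasurableSpace Ω] {Q : Kernel E E} [IsMarkovKernel Q] {P : E → Measure Ω} {X : ℕ → Ω → E}
  {δ : ℕ → ℝ} {f : E → ℝ} {A : Set E} {M : ℝ}

lemma IsMarkovProcess.delayedValue_mem_Icc (hX : IsMarkovProcess Q P X) (hδ : IsDiscount δ)
    (hf : Measurable f) (hM : 0 ≤ M) (hfM : ∀ y, f y ∈ Set.Icc 0 M) (hA : MeasurableSet A)
    (N s : ℕ) (x : E) :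
    delayedValue δ f P X A s x ∈ Set.Icc (truncatedValue Q δ f A N s x)
      (truncatedValue Q δ f A N s x + M * δ (s + N)) := by
  have := hX.isProbabilityMeasure x
  have hp : Integrable (pathPayoff δ f X A N s 0) (P x) :=
    integrable_of_nonneg_of_le (measurable_pathPayoff hf hX.measurable hA _ _ _)
      (fun ω => (pathPayoff_mem_Icc hδ hM hfM _ _ _ ω).1)
      fun ω => (pathPayoff_mem_Icc hδ hM hfM _ _ _ ω).2
  -- The bound is the horizon `0` case of the pathwise estimate, where the truncated payoff
  -- vanishes.
  have hd : Integrable (discountedPayoff (fun k => δ (s + k)) f X (returnTime X A)) (P x) :=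
    integrable_of_nonneg_of_le (M := 0 + M * δ (s + 0))
      (measurable_discountedPayoff hδ hf hM hfM hX.measurable hA s)
      (fun ω => (discountedPayoff_mem_Icc hδ hM hfM 0 s ω).1)
      fun ω => (discountedPayoff_mem_Icc hδ hM hfM 0 s ω).2
  rw [← hX.integral_pathPayoff hδ hf hM hfM hA x N s]
  refine ⟨integral_mono hp hd fun ω => (discountedPayoff_mem_Icc hδ hM hfM N s ω).1, ?_⟩
  calc delayedValue δ f P X A s x
      ≤ ∫ ω, (pathPayoff δ f X A N s 0 ω + M * δ (s + N)) ∂(P x) :=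
        integral_mono hd (hp.add (integrable_const _))
          fun ω => (discountedPayoff_mem_Icc hδ hM hfM N s ω).2
    _ = _ := by rw [integral_add hp (integrable_const _)]; simp

lemma IsMarkovProcess.tendsto_truncatedValue (hX : IsMarkovProcess Q P X) (hδ : IsDiscount δ)
    (hf : Measurable f) (hM : 0 ≤ M) (hfM : ∀ y, f y ∈ Set.Icc 0 M) (hA : MeasurableSet A)
    (s : ℕ) (x : E) :
    Tendsto (fun N => truncatedValue Q δ f A N s x) atTop (𝓝 (delayedValue δ f P X A s x)) := by
  have hlim : Tendsto (fun N => M * δ (s + N)) atTop (𝓝 0) := by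
    have := (hδ.tendsto.comp (tendsto_add_atTop_nat s)).const_mul M
    simpa [Function.comp_def, add_comm] using this
  exact tendsto_of_tendsto_of_tendsto_of_le_of_le
    (by simpa using tendsto_const_nhds.sub hlim) tendsto_const_nhds
    (fun N => sub_le_iff_le_add.2 (hX.delayedValue_mem_Icc hδ hf hM hfM hA N s x).2)
    (fun N => (hX.delayedValue_mem_Icc hδ hf hM hfM hA N s x).1)

lemma IsMarkovProcess.measurable_delayedValue (hX : IsMarkovProcess Q P X) (hδ : IsDiscount δ)
    (hf : Measurable f) (hM : 0 ≤ M) (hfM : ∀ y, f y ∈ Set.Icc 0 M) (hA : MeasurableSet A)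
    (s : ℕ) : Measurable (delayedValue δ f P X A s) :=
  measurable_of_tendsto_metrizable (fun N => measurable_truncatedValue Q hf hA N s)
    (tendsto_pi_nhds.2 fun x => hX.tendsto_truncatedValue hδ hf hM hfM hA s x)

lemma IsMarkovProcess.delayedValue_mem_Icc_zero (hX : IsMarkovProcess Q P X) (hδ : IsDiscount δ)
    (hf : Measurable f) (hM : 0 ≤ M) (hfM : ∀ y, f y ∈ Set.Icc 0 M) (hA : MeasurableSet A)
    (s : ℕ) (x : E) : delayedValue δ f P X A s x ∈ Set.Icc 0 M :=
  isClosed_Icc.mem_of_tendsto (hX.tendsto_truncatedValue hδ hf hM hfM hA s x)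
    (Eventually.of_forall fun N => truncatedValue_mem_Icc Q hδ hf hA hM hfM N s x)

open Classical in
/-- The one-step recursion satisfied by the values of return times. -/
lemma IsMarkovProcess.delayedValue_eq_integral (hX : IsMarkovProcess Q P X) (hδ : IsDiscount δ)
    (hf : Measurable f) (hM : 0 ≤ M) (hfM : ∀ y, f y ∈ Set.Icc 0 M) (hA : MeasurableSet A)
    (s : ℕ) (x : E) :
    delayedValue δ f P X A s x =
      ∫ y, A.piecewise (fun y => δ (s + 1) * f y) (delayedValue δ f P X A (s + 1)) y ∂(Q x) := by
  refine tendsto_nhds_unique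
    ((hX.tendsto_truncatedValue hδ hf hM hfM hA s x).comp (tendsto_add_atTop_nat 1)) ?_
  refine tendsto_integral_of_dominated_convergence (fun _ => M)
    (fun N => (Measurable.piecewise hA (hf.const_mul _)
      (measurable_truncatedValue Q hf hA N (s + 1))).aestronglyMeasurable)
    (integrable_const M) (fun N => ae_of_all _ fun y => ?_) (ae_of_all _ fun y => ?_)
  · have h := piecewise_mem_Icc (A := A) (fun y => hδ.mul_mem_Icc (hfM y) (s + 1))
      (truncatedValue_mem_Icc Q hδ hf hA hM hfM N (s + 1)) y
    rw [Real.norm_eq_abs, abs_of_nonneg h.1]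
    exact h.2
  · by_cases hy : y ∈ A
    · simp only [Set.piecewise, hy, if_true]
      exact tendsto_const_nhds
    · simp only [Set.piecewise, hy, if_false]
      exact hX.tendsto_truncatedValue hδ hf hM hfM hA (s + 1) y

/-- Under decreasing impatience, a payoff looks no worse when it is evaluated from the past. -/
lemma IsMarkovProcess.mul_delayedValue_le (hX : IsMarkovProcess Q P X) (hδ : IsDiscount δ)
    (hDI : DecreasingImpatience δ) (hf : Measurable f) (hM : 0 ≤ M)
    (hfM : ∀ y, f y ∈ Set.Icc 0 M) (hA : MeasurableSet A) (s : ℕ) (x : E) :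
    δ s * delayedValue δ f P X A 0 x ≤ delayedValue δ f P X A s x := by
  -- Induction on the horizon needs all elapsed times `t`; the stopping branch is `δ s * δ (t + 1) ≤
  -- δ (s + (t + 1))`.
  have key : ∀ N t y,
      δ s * truncatedValue Q δ f A N t y ≤ truncatedValue Q δ f A N (s + t) y := by
    classical
    intro N
    induction N with
    | zero => intro t y; simp [truncatedValue]
    | succ N ih =>
      intro t y
      have hmeas : ∀ r, Measurable (A.piecewise (fun y => δ (r + 1) * f y)
          (truncatedValue Q δ f A N (r + 1))) := fun r =>
        Measurable.piecewise hA (hf.const_mul _) (measurable_truncatedValue Q hf hA N (r + 1))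
      have hint : ∀ r, Integrable (A.piecewise (fun y => δ (r + 1) * f y)
          (truncatedValue Q δ f A N (r + 1))) (Q y) := fun r =>
        integrable_of_nonneg_of_le (hmeas r)
          (fun z => (piecewise_mem_Icc (fun y => hδ.mul_mem_Icc (hfM y) _)
            (truncatedValue_mem_Icc Q hδ hf hA hM hfM N (r + 1)) z).1)
          fun z => (piecewise_mem_Icc (fun y => hδ.mul_mem_Icc (hfM y) _)
            (truncatedValue_mem_Icc Q hδ hf hA hM hfM N (r + 1)) z).2
      simp only [truncatedValue]
      rw [← integral_const_mul]
      refine integral_mono ((hint t).const_mul _) (hint (s + t)) fun z => ?_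
      by_cases hz : z ∈ A
      · simp only [Set.piecewise, hz, if_true]
        rw [← mul_assoc]
        exact mul_le_mul_of_nonneg_right (hDI s (t + 1)) (hfM z).1
      · simp only [Set.piecewise, hz, if_false]
        exact ih (t + 1) z
  exact le_of_tendsto_of_tendsto'
    ((hX.tendsto_truncatedValue hδ hf hM hfM hA 0 x).const_mul _)
    (hX.tendsto_truncatedValue hδ hf hM hfM hA s x) fun N => key N 0 x

/-- If, wherever one of the stopping regions `S i ⊇ B` prescribes stopping outside of `B`,
continuing until the return time of some `S j` is at least as good, then waiting for the return time
of `B` is at least as good as waiting for that of any `S i`. -/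
lemma IsMarkovProcess.objective_returnTime_le (hX : IsMarkovProcess Q P X) (hδ : IsDiscount δ)
    (hDI : DecreasingImpatience δ) (hf : Measurable f) (hM : 0 ≤ M)
    (hfM : ∀ y, f y ∈ Set.Icc 0 M) {ι : Type*} {S : ι → Set E} {B : Set E}
    (hS : ∀ i, MeasurableSet (S i)) (hB : MeasurableSet B) (hBS : ∀ i, B ⊆ S i)
    (h : ∀ i, ∀ y ∈ S i, y ∉ B → ∃ j, f y ≤ objective δ f P X y (returnTime X (S j)))
    (i : ι) (x : E) :
    objective δ f P X x (returnTime X (S i)) ≤ objective δ f P X x (returnTime X B) := by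
  -- The claim is uniform in `s`, `i` and `x` because one step raises the elapsed time, moves the
  -- state and may replace `S i` by another `S j`.
  have key : ∀ n s i x,
      delayedValue δ f P X (S i) s x ≤ delayedValue δ f P X B s x + M * δ (s + n) := by
    classical
    intro n
    induction n with
    | zero =>
      intro s i x
      have h1 := (hX.delayedValue_mem_Icc hδ hf hM hfM (hS i) 0 s x).2
      have h2 := (hX.delayedValue_mem_Icc_zero hδ hf hM hfM hB s x).1
      simp only [truncatedValue] at h1
      linarith
    | succ n ih =>
      intro s i x
      have hint : ∀ A : Set E, MeasurableSet A →
          Integrable (A.piecewise (fun y => δ (s + 1) * f y) (delayedValue δ f P X A (s + 1)))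
            (Q x) := fun A hA =>
        integrable_of_nonneg_of_le (Measurable.piecewise hA (hf.const_mul _)
            (hX.measurable_delayedValue hδ hf hM hfM hA (s + 1)))
          (fun z => (piecewise_mem_Icc (fun y => hδ.mul_mem_Icc (hfM y) _)
            (hX.delayedValue_mem_Icc_zero hδ hf hM hfM hA (s + 1)) z).1)
          fun z => (piecewise_mem_Icc (fun y => hδ.mul_mem_Icc (hfM y) _)
            (hX.delayedValue_mem_Icc_zero hδ hf hM hfM hA (s + 1)) z).2
      have hc : 0 ≤ M * δ (s + (n + 1)) := mul_nonneg hM (hδ.mem_Icc _).1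
      have hs : s + (n + 1) = s + 1 + n := by omega
      rw [hX.delayedValue_eq_integral hδ hf hM hfM (hS i),
        hX.delayedValue_eq_integral hδ hf hM hfM hB]
      calc _ ≤ ∫ y, (B.piecewise (fun y => δ (s + 1) * f y)
              (delayedValue δ f P X B (s + 1)) y + M * δ (s + (n + 1))) ∂(Q x) := by
            refine integral_mono (hint _ (hS i)) ((hint _ hB).add (integrable_const _)) fun y => ?_
            by_cases hyB : y ∈ B
            · have hyS := hBS i hyB
              simp only [Set.piecewise, hyB, hyS, if_true]
              linarith
            by_cases hyS : y ∈ S i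
            · simp only [Set.piecewise, hyB, hyS, if_true, if_false]
              -- Stopping here is beaten by waiting for `S j`, even when discounted from `s + 1`
              -- periods ago; the induction hypothesis then compares `S j` with `B`.
              obtain ⟨j, hj⟩ := h i y hyS hyB
              rw [← delayedValue_zero] at hj
              have h1 := mul_le_mul_of_nonneg_left hj (hδ.mem_Icc (s + 1)).1
              have h2 := hX.mul_delayedValue_le hδ hDI hf hM hfM (hS j) (s + 1) y
              rw [hs]
              exact h1.trans (h2.trans (ih (s + 1) j y))
            · simp only [Set.piecewise, hyB, hyS, if_false]
              rw [hs]
              exact ih (s + 1) i y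
        _ = _ := by rw [integral_add (hint _ hB) (integrable_const _)]; simp
  rw [← delayedValue_zero, ← delayedValue_zero]
  have hlim : Tendsto (fun n => delayedValue δ f P X B 0 x + M * δ (0 + n)) atTop
      (𝓝 (delayedValue δ f P X B 0 x)) := by
    simpa using (hδ.tendsto.const_mul M).const_add (delayedValue δ f P X B 0 x)
  exact ge_of_tendsto' hlim fun n => key n 0 i x

lemma IsMarkovProcess.measurableSet_bestResponse (hX : IsMarkovProcess Q P X) (hδ : IsDiscount δ)
    (hf : Measurable f) (hM : 0 ≤ M) (hfM : ∀ y, f y ∈ Set.Icc 0 M) (hA : MeasurableSet A) :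
    MeasurableSet (bestResponse δ f P X A) := by
  have := hX.measurable_delayedValue hδ hf hM hfM hA 0
  simp only [funext (delayedValue_zero δ f P X A)] at this
  exact measurableSet_le this hf

/-- If the best response to `A` is contained in `A`, then iterating the best response yields an
equilibrium contained in `A`. -/
lemma IsMarkovProcess.exists_equilibrium_subset (hX : IsMarkovProcess Q P X) (hδ : IsDiscount δ)
    (hDI : DecreasingImpatience δ) (hf : Measurable f) (hM : 0 ≤ M)
    (hfM : ∀ y, f y ∈ Set.Icc 0 M) (hA : MeasurableSet A) (hsub : bestResponse δ f P X A ⊆ A) :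
    ∃ S ∈ equilibria δ f P X, S ⊆ A := by
  set S : ℕ → Set E := fun n => (bestResponse δ f P X)^[n] A with hSdef
  have hsucc : ∀ n, S (n + 1) = bestResponse δ f P X (S n) := fun n =>
    Function.iterate_succ_apply' _ _ _
  have hmeas : ∀ n, MeasurableSet (S n) := by
    intro n
    induction n with
    | zero => exact hA
    | succ n ih =>
      rw [hsucc]
      exact hX.measurableSet_bestResponse hδ hf hM hfM ih
  have hstep : ∀ n, S (n + 1) ⊆ S n := by
    intro n
    induction n with
    | zero => rw [hsucc]; exact hsub
    | succ n ih =>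
      -- Points of `S n` dropped from `S (n + 1)` are those where waiting for `S n` beats `f`, so
      -- shrinking the region raises `J` and hence shrinks `Θ`.
      have hle := hX.objective_returnTime_le hδ hDI hf hM hfM (ι := Unit) (S := fun _ => S n)
        (B := S (n + 1)) (fun _ => hmeas n) (hmeas (n + 1)) (fun _ => ih) fun _ y _ hy =>
          ⟨(), (lt_objective_of_notMem_bestResponse (by rwa [hsucc] at hy)).le⟩
      intro y hy
      rw [hsucc] at hy
      rw [hsucc n]
      exact (hle () y).trans hy
  have hanti : Antitone S := antitone_nat_of_succ_le hstep
  have hB : MeasurableSet (⋂ n, S n) := MeasurableSet.iInter hmeas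
  have hle := hX.objective_returnTime_le hδ hDI hf hM hfM hmeas hB (Set.iInter_subset S)
    fun n y _ hy => by
      obtain ⟨m, hm⟩ : ∃ m, y ∉ S m := by simpa using hy
      have hm' : y ∉ S (m + 1) := fun h => hm (hstep m h)
      rw [hsucc] at hm'
      exact ⟨m, (lt_objective_of_notMem_bestResponse hm').le⟩
  refine ⟨⋂ n, S n, ⟨hB, Set.Subset.antisymm (fun x hx => ?_) fun x hx => ?_⟩,
    Set.iInter_subset S 0⟩
  · refine Set.mem_iInter.2 fun n => hstep n ?_
    rw [hsucc]
    exact (hle n x).trans hx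
  -- The limit in `n` is taken at fixed horizon `N`, by dominated convergence; only afterwards does
  -- `N` tend to infinity.
  · have hbound : ∀ N, truncatedValue Q δ f (⋂ n, S n) N 0 x ≤ f x := fun N =>
      le_of_tendsto' (tendsto_truncatedValue_iInter Q hδ hf hM hfM hmeas hanti N 0 x) fun n => by
        have h1 := (hX.delayedValue_mem_Icc hδ hf hM hfM (hmeas n) N 0 x).1
        have h2 : x ∈ S (n + 1) := Set.mem_iInter.1 hx (n + 1)
        rw [hsucc] at h2
        rw [delayedValue_zero] at h1
        exact h1.trans h2
    have := le_of_tendsto' (hX.tendsto_truncatedValue hδ hf hM hfM hB 0 x) hbound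
    rw [delayedValue_zero] at this
    exact this

/-- Best responses are closed when the payoff is upper semicontinuous and the kernel is lower
semicontinuous. -/
lemma IsMarkovProcess.isClosed_bestResponse (hX : IsMarkovProcess Q P X) (hδ : IsDiscount δ)
    (hf : Measurable f) (hM : 0 ≤ M) (hfM : ∀ y, f y ∈ Set.Icc 0 M) (hA : MeasurableSet A)
    (hfu : UpperSemicontinuous f) (hQ : KernelLowerSemicontinuous Q) :
    IsClosed (bestResponse δ f P X A) := by
  classical
  refine IsSeqClosed.isClosed fun u x hu hux => ?_
  set g := A.piecewise (fun y => δ (0 + 1) * f y) (delayedValue δ f P X A (0 + 1))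
  have hgm : Measurable g := Measurable.piecewise hA (hf.const_mul _)
    (hX.measurable_delayedValue hδ hf hM hfM hA (0 + 1))
  have hgM : ∀ y, g y ∈ Set.Icc 0 M := piecewise_mem_Icc (fun y => hδ.mul_mem_Icc (hfM y) _)
    (hX.delayedValue_mem_Icc_zero hδ hf hM hfM hA (0 + 1))
  have hval : ∀ z, objective δ f P X z (returnTime X A) = ∫ y, g y ∂(Q z) := fun z => by
    rw [← delayedValue_zero]
    exact hX.delayedValue_eq_integral hδ hf hM hfM hA 0 z
  have hlsc := hQ g hgm ⟨M, fun y => by rw [abs_of_nonneg (hgM y).1]; exact (hgM y).2⟩ u x hux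
  change objective δ f P X x (returnTime X A) ≤ f x
  rw [hval]
  -- For any `c > f x`, upper semicontinuity puts `f (u n)`, hence the integrals, eventually below
  -- `c`.
  refine hlsc.trans (le_of_forall_gt_imp_ge_of_dense fun c hc => ?_)
  have hev : ∀ᶠ n in atTop, ∫ y, g y ∂(Q (u n)) ≤ c := by
    filter_upwards [hux.eventually (hfu x c hc)] with n hn
    rw [← hval]
    exact (show objective δ f P X (u n) (returnTime X A) ≤ f (u n) from hu n).trans hn.le
  exact liminf_le_of_frequently_le hev.frequently
    (isBoundedUnder_of ⟨0, fun n => (integral_mem_Icc hgm hgM).1⟩)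

end Value

end OptimalStopping

/-! ### The intersection of all equilibria -/

theorem theorem2 {E Ω : Type*} [TopologicalSpace E] [PolishSpace E] [MeasurableSpace E]
    [BorelSpace E] [MeasurableSpace Ω]
    (Q : Kernel E E) [IsMarkovKernel Q] (P : E → Measure Ω) (X : ℕ → Ω → E)
    (hX : OptimalStopping.IsMarkovProcess Q P X)
    (f : E → ℝ) (hf : OptimalStopping.IsPayoff f)
    (δ : ℕ → ℝ) (hδ : OptimalStopping.IsDiscount δ)
    (hDI : OptimalStopping.DecreasingImpatience δ)
    (hfu : UpperSemicontinuous f)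
    (hQ : OptimalStopping.KernelLowerSemicontinuous Q) :
    (∀ S ∈ OptimalStopping.equilibria δ f P X, IsClosed S) ∧
      ⋂₀ OptimalStopping.equilibria δ f P X ∈ OptimalStopping.equilibria δ f P X ∧
      OptimalStopping.IsOptimalEquilibrium δ f P X (⋂₀ OptimalStopping.equilibria δ f P X) ∧
      ∀ T : Set E, OptimalStopping.IsOptimalEquilibrium δ f P X T →
        T = ⋂₀ OptimalStopping.equilibria δ f P X := by
  obtain ⟨M, hM, hfM⟩ : ∃ M : ℝ, 0 ≤ M ∧ ∀ y, f y ∈ Set.Icc 0 M := by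
    obtain ⟨M, hM⟩ := hf.bounded
    exact ⟨max M 0, le_max_right _ _, fun y => ⟨hf.nonneg y, (hM y).trans (le_max_left _ _)⟩⟩
  have hfm := hf.measurable
  have hclosed : ∀ S ∈ OptimalStopping.equilibria δ f P X, IsClosed S := fun S hS => by
    rw [← hS.2]
    exact hX.isClosed_bestResponse hδ hfm hM hfM hS.1 hfu hQ
  set I := ⋂₀ OptimalStopping.equilibria δ f P X with hI
  -- The intersection may be uncountable; closedness is what makes it Borel.
  have hIm : MeasurableSet I := (isClosed_sInter hclosed).measurableSet
  have hle : ∀ S ∈ OptimalStopping.equilibria δ f P X, ∀ x,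
      OptimalStopping.objective δ f P X x (OptimalStopping.returnTime X S) ≤
        OptimalStopping.objective δ f P X x (OptimalStopping.returnTime X I) := by
    intro S hS
    refine hX.objective_returnTime_le hδ hDI hfm hM hfM
      (S := fun T : OptimalStopping.equilibria δ f P X => (T : Set E)) (fun T => T.2.1) hIm
      (fun T => Set.sInter_subset_of_mem T.2) (fun T y _ hy => ?_) ⟨S, hS⟩
    obtain ⟨R, hR, hyR⟩ : ∃ R ∈ OptimalStopping.equilibria δ f P X, y ∉ R := by
      simpa [hI, Set.mem_sInter] using hy
    rw [← hR.2] at hyR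
    exact ⟨⟨R, hR⟩, (OptimalStopping.lt_objective_of_notMem_bestResponse hyR).le⟩
  have hsub : OptimalStopping.bestResponse δ f P X I ⊆ I := fun x hx => by
    refine Set.mem_sInter.2 fun S hS => ?_
    rw [← hS.2]
    exact (hle S hS x).trans hx
  -- Existence is not presupposed: with no equilibria `I` would be the whole space, and the
  -- iteration would still produce one.
  have hIeq : I ∈ OptimalStopping.equilibria δ f P X := by
    obtain ⟨S, hS, hSI⟩ := hX.exists_equilibrium_subset hδ hDI hfm hM hfM hIm hsub
    rwa [← Set.Subset.antisymm hSI (Set.sInter_subset_of_mem hS)]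
  refine ⟨hclosed, hIeq, ⟨hIeq, fun T hT x => max_le_max le_rfl (hle T hT x)⟩, fun T hT => ?_⟩
  -- On an optimal `T` the value is `f`, so `J(x, I) ≤ V(x, I) ≤ f x` there, which places `x` in
  -- `Θ(I) = I`.
  refine Set.Subset.antisymm (fun x hx => ?_) (Set.sInter_subset_of_mem hT.1)
  rw [← hIeq.2]
  rw [← hT.1.2] at hx
  have h1 : OptimalStopping.value δ f P X x I ≤ OptimalStopping.value δ f P X x T :=
    hT.2 I hIeq x
  have h2 : OptimalStopping.value δ f P X x T = f x := max_eq_left hx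
  exact (le_max_right _ _).trans (h1.trans_eq h2)
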